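/- Let $q\ge 2$ and $n\ge\max\{\frac{q+23}{2},\frac{5q+19}{q-1}\}$ be integers, and let $\Sigma_q=\{0,1,\dots,q-1\}$. For $x,x'\in\Sigma_q^n$ let $d_H(x,x')$ be their Hamming distance, and let $B^{D,S}_{1,1}(x)\subseteq\Sigma_q^{n-1}$ be the set of all words that can be obtained from $x$ by deleting exactly one symbol and substituting at most one symbol. Let $\delta_{q,2}=1$ if $q=2$ and $\delta_{q,2}=0$ otherwise. Then for all $x,x'\in\Sigma_q^n$ with $d_H(x,x')\ge 2$, $$|B^{D,S}_{1,1}(x)\cap B^{D,S}_{1,1}(x')|\le 2qn-3q-2-\delta_{q,2}.$$ The bound is tight: there exist $x,x'\in\Sigma_q^n$ with $d_H(x,x')=2$ and $$|B^{D,S}_{1,1}(x)\cap B^{D,S}_{1,1}(x')|=2qn-3q-2-\delta_{q,2}.$$ Explicitly, writing $A_m(01)=0101\cdots$ for the alternating word of length $m$ that starts with $0$ and consists of the symbols $0,1$, the pair $x=01201A_{n-5}(01)$, $x'=10201A_{n-5}(01)$ has both properties if $q\ge 3$, and the pair $x=0101A_{n-4}(01)$, $x'=1001A_{n-4}(01)$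 has both properties if $q=2$. -/

import Mathlib

/-- The `t`-deletion `s`-substitution ball of the word `x` of length `n`: the words `y` of length
`n - t` which are obtained from `x` by deleting exactly `t` symbols, so that the subsequence of `x`
at the positions `D 0 < D 1 < ⋯` remains, and by substituting at most `s` symbols. (Substituting
before or after deleting gives the same words.) -/
def delSubBall {α : Type*} [DecidableEq α] {n : ℕ} (t s : ℕ) (x : Fin n → α) :
    Set (Fin (n - t) → α) :=
  {y | ∃ D : Fin (n - t) ↪o Fin n, hammingDist (x ∘ D) y ≤ s}

/-- The alternating word `abab⋯` of length `n`. -/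
def alternating {α : Type*} (a b : α) (n : ℕ) : Fin n → α :=
  fun i => if (i : ℕ) % 2 = 0 then a else b

/-!
Cut `x = p a m c s` and `x' = p a' m' c' s` at the first and at the last position where they
differ. A common word of the two balls records a deletion in each of `x` and `x'`. If both deletions
fall into the same of the three regions, the ends `a`, `a'`, `c`, `c'` leave a linear number of
choices, and a bounded one unless `m = m'`. If the deletion in `x` comes first, the number of
choices is bounded unless `m c = a' m'`, in which case the common words essentially form the
substitution ball of `p m c s`, of size `(n - 1) (q - 1) + 1`; the same applies with `x` and `x'`
exchanged. The only pairs with all three contributions are `p a b s` and `p b a s`. There the two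
substitution balls share `q` words, and each of the words `p g g v`, `v g g s` with `g ∈ {a, b}` is
counted only if it lies outside them; near either end of `s` or `p` some of these words fall inside,
which accounts for the exact constant. For `p = ∅` and `s` without equal adjacent symbols
nothing else is lost, and the bound is attained.
-/

section Mismatches

variable {α : Type*} [DecidableEq α]

/-- The Hamming distance of two words of the same length; of words of different lengths, the longer
one is cut off. -/
def mismatches (x y : List α) : ℕ :=
  (x.zip y).countP fun z => z.1 ≠ z.2

@[simp] theorem mismatches_nil_left (y : List α) : mismatches [] y = 0 := by
  simp [mismatches]

@[simp] theorem mismatches_cons (a b : α) (x y : List α) :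
    mismatches (a :: x) (b :: y) = mismatches x y + if a = b then 0 else 1 := by
  by_cases h : a = b <;> simp [mismatches, h]

@[simp] theorem mismatches_self (x : List α) : mismatches x x = 0 := by
  induction x with
  | nil => simp
  | cons a x ih => simp [ih]

theorem mismatches_comm (x y : List α) : mismatches x y = mismatches y x := by
  rw [mismatches, mismatches, ← List.zip_swap y x, List.countP_map]
  exact List.countP_congr fun _ _ => by simpa using ne_comm

theorem mismatches_le_length (x y : List α) : mismatches x y ≤ y.length :=
  List.countP_le_length.trans (by simp)

theorem mismatches_append {u v : List α} (h : u.length = v.length) (x y : List α) :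
    mismatches (u ++ x) (v ++ y) = mismatches u v + mismatches x y := by
  rw [mismatches, List.zip_append h, List.countP_append, mismatches, mismatches]

theorem mismatches_append_left (u x y : List α) :
    mismatches (u ++ x) (u ++ y) = mismatches x y := by
  simp [mismatches_append]

theorem mismatches_append_right {u v : List α} (h : u.length = v.length) (x : List α) :
    mismatches (u ++ x) (v ++ x) = mismatches u v := by
  simp [mismatches_append h]

theorem mismatches_reverse {x y : List α} (h : x.length = y.length) :
    mismatches x.reverse y.reverse = mismatches x y := by
  simp [mismatches, List.zip, ← List.reverse_zipWith h]

theorem mismatches_eq_zero {x y : List α} (h : x.length = y.length) :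
    mismatches x y = 0 ↔ x = y := by
  induction x generalizing y with
  | nil => cases y <;> simp_all
  | cons a x ih => cases y with
    | nil => simp at h
    | cons b y => simp [ih (by simpa using h), and_comm]

theorem mismatches_triangle {x y z : List α} (hxy : x.length = y.length)
    (hyz : y.length = z.length) : mismatches x z ≤ mismatches x y + mismatches y z := by
  induction x generalizing y z with
  | nil => simp
  | cons a x ih =>
    obtain ⟨b, y, rfl⟩ := List.exists_cons_of_length_eq_add_one hxy.symm
    obtain ⟨c, z, rfl⟩ := List.exists_cons_of_length_eq_add_one hyz.symm
    have := ih (y := y) (z := z) (by simpa using hxy) (by simpa using hyz)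
    grind [mismatches_cons]

end Mismatches

section Deletions

variable {α : Type*} [DecidableEq α]

/-- The words obtained from a word by deleting exactly one symbol. -/
def deletions : List α → Finset (List α)
  | [] => ∅
  | c :: t => insert t ((deletions t).image (List.cons c))

@[simp] theorem deletions_nil : deletions ([] : List α) = ∅ := rfl

theorem mem_deletions_cons {c : α} {t u : List α} :
    u ∈ deletions (c :: t) ↔ u = t ∨ ∃ v ∈ deletions t, u = c :: v := by
  simp [deletions, eq_comm]

theorem tail_mem_deletions_cons (c : α) (t : List α) : t ∈ deletions (c :: t) :=
  mem_deletions_cons.2 (.inl rfl)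

theorem cons_mem_deletions_cons {t u : List α} (c : α) (h : u ∈ deletions t) :
    c :: u ∈ deletions (c :: t) :=
  mem_deletions_cons.2 (.inr ⟨u, h, rfl⟩)

theorem mem_deletions_append {x y u : List α} : u ∈ deletions (x ++ y) ↔
    (∃ v ∈ deletions x, u = v ++ y) ∨ ∃ v ∈ deletions y, u = x ++ v := by
  induction x generalizing u with
  | nil => simp
  | cons a x ih =>
    simp only [List.cons_append, mem_deletions_cons, ih]
    constructor
    · rintro (rfl | ⟨_, ⟨v, hv, rfl⟩ | ⟨v, hv, rfl⟩, rfl⟩)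
      · exact .inl ⟨x, .inl rfl, rfl⟩
      · exact .inl ⟨a :: v, .inr ⟨v, hv, rfl⟩, rfl⟩
      · exact .inr ⟨v, hv, rfl⟩
    · rintro (⟨_, rfl | ⟨v, hv, rfl⟩, rfl⟩ | ⟨v, hv, rfl⟩)
      · exact .inl rfl
      · exact .inr ⟨_, .inl ⟨v, hv, rfl⟩, rfl⟩
      · exact .inr ⟨_, .inr ⟨v, hv, rfl⟩, rfl⟩

theorem mem_deletions_concat {t u : List α} {c : α} :
    u ∈ deletions (t ++ [c]) ↔ u = t ∨ ∃ v ∈ deletions t, u = v ++ [c] := by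
  simp [mem_deletions_append, mem_deletions_cons, or_comm]

theorem mem_deletions_iff_sublist {x u : List α} :
    u ∈ deletions x ↔ u.Sublist x ∧ u.length + 1 = x.length := by
  constructor
  · intro h
    induction x generalizing u with
    | nil => simp at h
    | cons c t ih =>
      obtain rfl | ⟨v, hv, rfl⟩ := mem_deletions_cons.1 h
      · simp
      · simpa using ih hv
  · rintro ⟨h, hl⟩
    induction h with
    | slnil => simp at hl
    | cons c h _ =>
      rw [h.eq_of_length (by simpa using hl)]
      exact tail_mem_deletions_cons _ _
    | cons_cons c _ ih => exact cons_mem_deletions_cons c (ih (by simpa using hl))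

theorem length_of_mem_deletions {x u : List α} (h : u ∈ deletions x) : u.length + 1 = x.length :=
  (mem_deletions_iff_sublist.1 h).2

theorem reverse_mem_deletions_reverse {x u : List α} :
    u.reverse ∈ deletions x.reverse ↔ u ∈ deletions x := by
  simp [mem_deletions_iff_sublist]

theorem card_deletions_le (x : List α) : (deletions x).card ≤ x.length := by
  induction x with
  | nil => simp
  | cons c t ih =>
    exact (Finset.card_insert_le _ _).trans (Nat.succ_le_succ (Finset.card_image_le.trans ih))

theorem card_deletions_of_isChain {x : List α} (h : x.IsChain (· ≠ ·)) :
    (deletions x).card = x.length := by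
  induction x with
  | nil => simp
  | cons c t ih =>
    rw [deletions, Finset.card_insert_of_notMem, Finset.card_image_of_injective _
      List.cons_injective, ih h.tail, List.length_cons]
    intro ht
    obtain ⟨v, -, rfl⟩ := Finset.mem_image.1 ht
    simp at h

theorem card_deletions_inter_le_two {x y : List α} (h : x ≠ y) :
    (deletions x ∩ deletions y).card ≤ 2 := by
  induction x generalizing y with
  | nil => simp
  | cons a x ih =>
    cases y with
    | nil => simp
    | cons b y =>
      by_cases hab : a = b
      · subst hab
        have hxy : x ≠ y := by simpa using h
        refine (Finset.card_le_card (t := (deletions x ∩ deletions y).image (List.cons a))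
          fun _ hu => ?_).trans (Finset.card_image_le.trans (ih hxy))
        simp only [Finset.mem_inter, mem_deletions_cons, Finset.mem_image] at hu ⊢
        grind [mem_deletions_cons]
      · refine (Finset.card_le_card (t := {x, y}) fun u hu => ?_).trans Finset.card_le_two
        simp only [Finset.mem_inter, mem_deletions_cons, Finset.mem_insert,
          Finset.mem_singleton] at hu ⊢
        grind

/-- Deleting the `i`-th symbol of `c t` leaves a word at distance `i` from `t`, not counting
repetitions of a symbol. -/
theorem injOn_mismatches_deletions_cons (c : α) (t : List α) :
    Set.InjOn (mismatches · t) (deletions (c :: t) : Set (List α)) := by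
  induction t generalizing c with
  | nil => simp [deletions]
  | cons b t ih =>
    have cases_of_mem : ∀ u ∈ deletions (c :: b :: t),
        c ≠ b ∧ u = b :: t ∨ ∃ v ∈ deletions (b :: t), u = c :: v := by
      intro u hu
      obtain rfl | h := mem_deletions_cons.1 hu
      · by_cases hcb : c = b
        · exact .inr ⟨t, tail_mem_deletions_cons b t, by rw [hcb]⟩
        · exact .inl ⟨hcb, rfl⟩
      · exact .inr h
    intro u hu v hv h
    obtain ⟨hc, rfl⟩ | ⟨u, hu', rfl⟩ := cases_of_mem u hu <;>
      obtain ⟨hc', rfl⟩ | ⟨v, hv', rfl⟩ := cases_of_mem v hv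
    · rfl
    · simp [hc] at h
    · simp [hc'] at h
    · rw [ih b hu' hv' (by simpa using h)]

theorem card_deletions_cons_filter_le (c : α) (t : List α) (I : Finset ℕ) :
    ((deletions (c :: t)).filter (mismatches · t ∈ I)).card ≤ I.card :=
  Finset.card_le_card_of_injOn (mismatches · t) (fun _ hu => (Finset.mem_filter.1 hu).2)
    ((injOn_mismatches_deletions_cons c t).mono (Finset.coe_subset.2 (Finset.filter_subset _ _)))

theorem card_deletions_cons_filter_mismatches_eq_one_le (c : α) {t z : List α}
    (hz : z.length = t.length) :
    ((deletions (c :: t)).filter (mismatches z · = 1)).card ≤ 3 := by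
  refine (Finset.card_le_card fun u hu => ?_).trans ((card_deletions_cons_filter_le c t
    (Finset.Icc (mismatches z t - 1) (mismatches z t + 1))).trans (by simp; omega))
  obtain ⟨hu, hzu⟩ := Finset.mem_filter.1 hu
  have hut : u.length = t.length := by simpa using length_of_mem_deletions hu
  have h₁ := mismatches_triangle (hz.trans hut.symm) hut
  have h₂ := mismatches_triangle (hut.trans hz.symm) hz
  rw [mismatches_comm u z] at h₂
  simp only [Finset.mem_filter, Finset.mem_Icc, hu, true_and]
  omega

end Deletions

section Substitutions

variable {α : Type*} [DecidableEq α] [Fintype α]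

/-- The words obtained from a word by substituting at most one symbol. -/
def substitutions : List α → Finset (List α)
  | [] => {[]}
  | c :: t => (substitutions t).image (List.cons c) ∪ (Finset.univ.erase c).image (· :: t)

theorem mem_substitutions {u y : List α} :
    y ∈ substitutions u ↔ u.length = y.length ∧ mismatches u y ≤ 1 := by
  induction u generalizing y with
  | nil => simp [substitutions, eq_comm]
  | cons a u ih =>
    cases y with
    | nil => simp [substitutions]
    | cons b y =>
      by_cases hab : a = b
      · subst hab
        simp [substitutions, ih]
      · have hu : u = y ↔ u.length = y.length ∧ mismatches u y = 0 :=
          ⟨fun h => by simp [h], fun h => (mismatches_eq_zero h.1).1 h.2⟩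
        simp [substitutions, hab, Ne.symm hab, hu]

theorem self_mem_substitutions (u : List α) : u ∈ substitutions u := by
  simp [mem_substitutions]

theorem length_of_mem_substitutions {u y : List α} (h : y ∈ substitutions u) :
    u.length = y.length :=
  (mem_substitutions.1 h).1

theorem mem_substitutions_comm {u y : List α} : y ∈ substitutions u ↔ u ∈ substitutions y := by
  rw [mem_substitutions, mem_substitutions, mismatches_comm, eq_comm]

theorem reverse_mem_substitutions_reverse {u y : List α} :
    y.reverse ∈ substitutions u.reverse ↔ y ∈ substitutions u := by
  simp +contextual [mem_substitutions, mismatches_reverse]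

theorem card_substitutions (u : List α) :
    (substitutions u).card = 1 + u.length * (Fintype.card α - 1) := by
  induction u with
  | nil => simp [substitutions]
  | cons a u ih =>
    have hdisj : Disjoint ((substitutions u).image (List.cons a))
        ((Finset.univ.erase a).image (· :: u)) := by
      simp +contextual [Finset.disjoint_left]
    rw [substitutions, Finset.card_union_of_disjoint hdisj,
      Finset.card_image_of_injective _ List.cons_injective,
      Finset.card_image_of_injective _ fun g g' hg => (List.cons.inj hg).1, ih,
      Finset.card_erase_of_mem (Finset.mem_univ a), Finset.card_univ, List.length_cons]
    ring

theorem mem_substitutions_append {u v y : List α} : y ∈ substitutions (u ++ v) ↔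
    (∃ z ∈ substitutions u, y = z ++ v) ∨ ∃ z ∈ substitutions v, y = u ++ z := by
  constructor
  · intro hy
    rw [mem_substitutions, List.length_append] at hy
    obtain ⟨z, w, rfl, hz⟩ : ∃ z w, y = z ++ w ∧ u.length = z.length :=
      ⟨_, _, (List.take_append_drop u.length y).symm, by simp; omega⟩
    have hw : v.length = w.length := by simpa [hz] using hy.1
    rw [mismatches_append hz] at hy
    obtain h | h : mismatches u z = 0 ∨ mismatches v w = 0 := by omega
    · exact .inr ⟨w, mem_substitutions.2 ⟨hw, by omega⟩, by rw [(mismatches_eq_zero hz).1 h]⟩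
    · exact .inl ⟨z, mem_substitutions.2 ⟨hz, by omega⟩, by rw [(mismatches_eq_zero hw).1 h]⟩
  · rintro (⟨z, hz, rfl⟩ | ⟨z, hz, rfl⟩) <;> rw [mem_substitutions] at hz ⊢
    · simpa [mismatches_append_right hz.1] using hz
    · simpa [mismatches_append_left] using hz

theorem append_cons_mem_substitutions (u : List α) (g c : α) (v : List α) :
    u ++ g :: v ∈ substitutions (u ++ c :: v) := by
  refine mem_substitutions.2 ⟨by simp, ?_⟩
  rw [mismatches_append_left, mismatches_cons, mismatches_self]
  split_ifs <;> simp

theorem mem_substitutions_inter_append {u₁ u₂ v₁ v₂ y : List α} (h₁ : u₁.length = v₁.length)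
    (hu : y ∈ substitutions (u₁ ++ u₂)) (hv : y ∈ substitutions (v₁ ++ v₂)) :
    (u₁ = v₁ ∧ ∃ z ∈ substitutions u₂ ∩ substitutions v₂, y = u₁ ++ z) ∨
    (u₂ = v₂ ∧ ∃ z ∈ substitutions u₁ ∩ substitutions v₁, y = z ++ u₂) ∨
    mismatches u₁ v₁ = 1 ∧ mismatches u₂ v₂ = 1 ∧ (y = u₁ ++ v₂ ∨ y = v₁ ++ u₂) := by
  have split_of_ne : u₁ ≠ v₁ → u₂ ≠ v₂ → v₁ ∈ substitutions u₁ → v₂ ∈ substitutions u₂ →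
      mismatches u₁ v₁ = 1 ∧ mismatches u₂ v₂ = 1 := by
    intro hne₁ hne₂ h₁ h₂
    rw [mem_substitutions] at h₁ h₂
    have := (mismatches_eq_zero h₁.1).not.2 hne₁
    have := (mismatches_eq_zero h₂.1).not.2 hne₂
    omega
  obtain ⟨z, hz, rfl⟩ | ⟨z, hz, rfl⟩ := mem_substitutions_append.1 hu <;>
    obtain ⟨w, hw, h⟩ | ⟨w, hw, h⟩ := mem_substitutions_append.1 hv
  · obtain ⟨rfl, rfl⟩ := List.append_inj h
      ((length_of_mem_substitutions hz).symm.trans (h₁.trans (length_of_mem_substitutions hw)))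
    exact .inr (.inl ⟨rfl, z, Finset.mem_inter.2 ⟨hz, hw⟩, rfl⟩)
  · obtain ⟨rfl, rfl⟩ := List.append_inj h ((length_of_mem_substitutions hz).symm.trans h₁)
    by_cases hne₁ : u₁ = z
    · exact .inl ⟨hne₁, u₂, Finset.mem_inter.2 ⟨self_mem_substitutions _, hw⟩, by rw [hne₁]⟩
    by_cases hne₂ : u₂ = v₂
    · exact .inr (.inl ⟨hne₂, z, Finset.mem_inter.2 ⟨hz, self_mem_substitutions _⟩, rfl⟩)
    obtain ⟨hd₁, hd₂⟩ := split_of_ne hne₁ hne₂ hz (mem_substitutions_comm.1 hw)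
    exact .inr (.inr ⟨hd₁, hd₂, .inr rfl⟩)
  · obtain ⟨rfl, rfl⟩ := List.append_inj h (h₁.trans (length_of_mem_substitutions hw))
    by_cases hne₁ : u₁ = v₁
    · exact .inl ⟨hne₁, z, Finset.mem_inter.2 ⟨hz, self_mem_substitutions _⟩, rfl⟩
    by_cases hne₂ : u₂ = z
    · exact .inr (.inl ⟨hne₂, u₁, Finset.mem_inter.2 ⟨self_mem_substitutions _, hw⟩, by rw [hne₂]⟩)
    obtain ⟨hd₁, hd₂⟩ := split_of_ne hne₁ hne₂ (mem_substitutions_comm.1 hw) hz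
    exact .inr (.inr ⟨hd₁, hd₂, .inl rfl⟩)
  · obtain ⟨rfl, rfl⟩ := List.append_inj h h₁
    exact .inl ⟨rfl, z, Finset.mem_inter.2 ⟨hz, hw⟩, rfl⟩

theorem mem_substitutions_inter_cons {a b : α} {u v y : List α}
    (hu : y ∈ substitutions (a :: u)) (hv : y ∈ substitutions (b :: v)) :
    (a = b ∧ ∃ z ∈ substitutions u ∩ substitutions v, y = a :: z) ∨
    (u = v ∧ ∃ g, y = g :: u) ∨
    a ≠ b ∧ mismatches u v = 1 ∧ (y = a :: v ∨ y = b :: u) := by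
  obtain ⟨hab, z, hz, rfl⟩ | ⟨huv, z, hz, rfl⟩ | ⟨hab, huv, hy⟩ :=
    mem_substitutions_inter_append (u₁ := [a]) (v₁ := [b]) rfl hu hv
  · exact .inl ⟨by simpa using hab, z, hz, rfl⟩
  · obtain ⟨g, rfl⟩ := List.length_eq_one_iff.1
      (length_of_mem_substitutions (Finset.mem_inter.1 hz).1).symm
    exact .inr (.inl ⟨huv, g, rfl⟩)
  · exact .inr (.inr ⟨by simpa using hab, huv, hy⟩)

theorem card_substitutions_inter_le {u v : List α} (hl : u.length = v.length) (huv : u ≠ v) :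
    (substitutions u ∩ substitutions v).card ≤
      if mismatches u v = 1 then Fintype.card α else 2 := by
  induction u generalizing v with
  | nil => cases v <;> simp_all
  | cons a u ih =>
    obtain ⟨b, v, rfl⟩ := List.exists_cons_of_length_eq_add_one hl.symm
    have hl' : u.length = v.length := by simpa using hl
    by_cases hab : a = b
    · subst hab
      have huv' : u ≠ v := by simpa using huv
      rw [show mismatches (a :: u) (a :: v) = mismatches u v by simp]
      refine (Finset.card_le_card fun y hy => ?_).trans
        ((Finset.card_image_le (f := List.cons a)).trans (ih hl' huv'))
      rw [Finset.mem_inter] at hy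
      obtain ⟨-, z, hz, rfl⟩ | ⟨h, -⟩ | ⟨h, -⟩ := mem_substitutions_inter_cons hy.1 hy.2
      · exact Finset.mem_image_of_mem _ hz
      · exact absurd h huv'
      · exact absurd rfl h
    · by_cases huv' : u = v
      · subst huv'
        rw [if_pos (by simp [hab]), ← Finset.card_univ]
        refine (Finset.card_le_card fun y hy => ?_).trans (Finset.card_image_le (f := (· :: u)))
        rw [Finset.mem_inter] at hy
        obtain ⟨h, -⟩ | ⟨-, g, rfl⟩ | ⟨-, h, -⟩ := mem_substitutions_inter_cons hy.1 hy.2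
        · exact absurd h hab
        · exact Finset.mem_image_of_mem _ (Finset.mem_univ g)
        · simp at h
      · rw [if_neg (by simp [hab, mismatches_eq_zero hl', huv'])]
        refine (Finset.card_le_card (t := {a :: v, b :: u}) fun y hy => ?_).trans
          Finset.card_le_two
        rw [Finset.mem_inter] at hy
        obtain ⟨h, -⟩ | ⟨h, -⟩ | ⟨-, -, h⟩ := mem_substitutions_inter_cons hy.1 hy.2
        · exact absurd h hab
        · exact absurd h huv'
        · simpa using h

/-- The words obtained from a word by deleting one symbol and then substituting at most one. -/
def delSubWords (x : List α) : Finset (List α) :=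
  (deletions x).biUnion substitutions

theorem mem_delSubWords {x y : List α} :
    y ∈ delSubWords x ↔ ∃ u ∈ deletions x, y ∈ substitutions u :=
  Finset.mem_biUnion

end Substitutions

section Shifts

variable {α : Type*} [DecidableEq α]

/-- The words at distance exactly one from `s` that are obtained by deleting a symbol of `f s`. -/
def suffixShifts (f : α) (s : List α) : Finset (List α) :=
  (deletions (f :: s)).filter (mismatches · s = 1)

/-- The words at distance exactly one from `p` that are obtained by deleting a symbol of `p a`. -/
def prefixShifts (p : List α) (a : α) : Finset (List α) :=
  (deletions (p ++ [a])).filter (mismatches · p = 1)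

@[simp] theorem suffixShifts_nil (f : α) : suffixShifts f [] = ∅ := by
  simp [suffixShifts, deletions]

@[simp] theorem prefixShifts_nil (a : α) : prefixShifts [] a = ∅ := by
  simp [prefixShifts, deletions]

theorem mem_suffixShifts {f : α} {s σ : List α} :
    σ ∈ suffixShifts f s ↔ σ ∈ deletions (f :: s) ∧ mismatches σ s = 1 :=
  Finset.mem_filter

theorem mem_prefixShifts {a : α} {p π : List α} :
    π ∈ prefixShifts p a ↔ π ∈ deletions (p ++ [a]) ∧ mismatches π p = 1 :=
  Finset.mem_filter

theorem reverse_mem_prefixShifts_reverse {f : α} {s σ : List α} :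
    σ.reverse ∈ prefixShifts s.reverse f ↔ σ ∈ suffixShifts f s := by
  rw [mem_prefixShifts, mem_suffixShifts, ← List.reverse_cons, reverse_mem_deletions_reverse]
  refine and_congr_right fun h => ?_
  rw [mismatches_reverse (by simpa using length_of_mem_deletions h)]

theorem length_of_mem_suffixShifts {f : α} {s σ : List α} (h : σ ∈ suffixShifts f s) :
    σ.length = s.length := by
  simpa using length_of_mem_deletions (mem_suffixShifts.1 h).1

theorem length_of_mem_prefixShifts {a : α} {p π : List α} (h : π ∈ prefixShifts p a) :
    π.length = p.length := by
  simpa using length_of_mem_deletions (mem_prefixShifts.1 h).1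

theorem card_suffixShifts_le_one (f : α) (s : List α) : (suffixShifts f s).card ≤ 1 := by
  simpa [suffixShifts] using card_deletions_cons_filter_le f s {1}

theorem card_prefixShifts_le_one (p : List α) (a : α) : (prefixShifts p a).card ≤ 1 := by
  refine le_trans (Finset.card_le_card_of_injOn List.reverse (fun π hπ => ?_)
    List.reverse_injective.injOn) (card_suffixShifts_le_one a p.reverse)
  rw [Finset.mem_coe, ← reverse_mem_prefixShifts_reverse]
  simpa using hπ

end Shifts

/-- Two words `p a m c s` and `p a' m' c' s` of the same length, cut at the first and at the last
position where they differ; these two positions are assumed to be distinct. -/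
structure SplitPair (α : Type*) where
  p : List α
  (a a' : α)
  (m m' : List α)
  (c c' : α)
  s : List α
  ne_first : a ≠ a'
  ne_last : c ≠ c'
  length_eq : m.length = m'.length

namespace SplitPair

section Symmetries

variable {α : Type*} (K : SplitPair α)

/-- The first word of the pair. -/
def fst : List α := K.p ++ K.a :: (K.m ++ K.c :: K.s)

/-- The second word of the pair. -/
def snd : List α := K.p ++ K.a' :: (K.m' ++ K.c' :: K.s)

/-- The pair with its two words exchanged. -/
def swap : SplitPair α :=
  ⟨K.p, K.a', K.a, K.m', K.m, K.c', K.c, K.s, K.ne_first.symm, K.ne_last.symm, K.length_eq.symm⟩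

/-- The pair read backwards. Its two words are exchanged, so that a deletion in the first word which
precedes the one in the second word keeps doing so. -/
def mirror : SplitPair α :=
  ⟨K.s.reverse, K.c', K.c, K.m'.reverse, K.m.reverse, K.a', K.a, K.p.reverse,
    K.ne_last.symm, K.ne_first.symm, by simp [K.length_eq]⟩

/-- Deleting `a` from the first word gives the same word as deleting `c'` from the second. -/
def IsShift : Prop := K.m ++ [K.c] = K.a' :: K.m'

end Symmetries

section Families

variable {α : Type*} [DecidableEq α] (K : SplitPair α)

instance : Decidable K.IsShift :=
  inferInstanceAs (Decidable (_ = _))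

/-- The words at distance one from `p` and `s` at both ends, arising from a deletion in `p a` and
from one in `c' s`. -/
def doubleShiftWords : Finset (List α) :=
  (prefixShifts K.p K.a ×ˢ suffixShifts K.c' K.s).image
    fun z => z.1 ++ (K.a' :: K.m' ++ z.2)

/-- The common subwords that arise, if at all, by substituting the ends of the middle part by `g`
and `e` and deleting a symbol elsewhere. -/
def hybridWords (g e : α) : Finset (List α) :=
  (if K.m = K.m' then (deletions K.p).image (· ++ g :: (K.m ++ e :: K.s)) ∪
    (deletions K.s).image (fun v => K.p ++ g :: (K.m ++ e :: v)) else ∅) ∪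
  (deletions K.m ∩ deletions K.m').image (fun v => K.p ++ g :: (v ++ e :: K.s))

/-- A superset of the words obtained when the symbols deleted from the two words lie in the same
one of the three regions. -/
def parallelWords : Finset (List α) :=
  K.hybridWords K.a K.c' ∪ K.hybridWords K.a' K.c

variable [Fintype α]

/-- A superset of the words obtained when the symbol deleted from the first word lies in `p a` and
the one deleted from the second in `a' m'`. -/
def leftWords : Finset (List α) :=
  Finset.univ.image (fun g => K.p ++ (K.m ++ g :: K.s)) ∪
  ((deletions (K.a' :: K.m')).filter (mismatches K.m · = 1)).image
    (fun z => K.p ++ (z ++ K.c :: K.s)) ∪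
  (prefixShifts K.p K.a).image (· ++ (K.m ++ K.c' :: K.s))

/-- A superset of the words obtained when the symbol deleted from the first word lies in `m c` and
the one deleted from the second in `c' s`. -/
def rightWords : Finset (List α) :=
  K.mirror.leftWords.image List.reverse

/-- A superset of the words obtained when the symbol deleted from the first word lies in `p a` and
the one deleted from the second in `c' s`. -/
def cornerWords : Finset (List α) :=
  (substitutions (K.p ++ ((K.m ++ [K.c]) ++ K.s)) ∩
    substitutions (K.p ++ (K.a' :: K.m' ++ K.s))) ∪
  (prefixShifts K.p K.a).image (· ++ (K.a' :: K.m' ++ K.s)) ∪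
  (suffixShifts K.c' K.s).image (fun σ => K.p ++ ((K.m ++ [K.c]) ++ σ)) ∪
  if K.IsShift then K.doubleShiftWords else ∅

/-- A superset of the words obtained when the symbol deleted from the first word precedes the one
deleted from the second, in different regions. -/
def crossWords : Finset (List α) :=
  K.leftWords ∪ K.rightWords ∪ K.cornerWords

end Families

section Cover

variable {α : Type*} {K : SplitPair α}

theorem length_middle_eq : (K.m ++ [K.c]).length = (K.a' :: K.m').length := by
  simp [K.length_eq]

variable [DecidableEq α]

theorem mem_deletions_fst {u : List α} (hu : u ∈ deletions K.fst) :
    (∃ π ∈ deletions (K.p ++ [K.a]), u = π ++ (K.m ++ K.c :: K.s)) ∨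
    (∃ z ∈ deletions K.m, u = K.p ++ K.a :: (z ++ K.c :: K.s)) ∨
    ∃ σ ∈ deletions (K.c :: K.s), u = K.p ++ K.a :: (K.m ++ σ) := by
  rw [fst, show K.p ++ K.a :: (K.m ++ K.c :: K.s) = (K.p ++ [K.a]) ++ (K.m ++ K.c :: K.s) by simp,
    mem_deletions_append] at hu
  obtain h | ⟨v, hv, rfl⟩ := hu
  · exact .inl h
  · right
    obtain ⟨z, hz, rfl⟩ | ⟨σ, hσ, rfl⟩ := mem_deletions_append.1 hv
    · exact .inl ⟨z, hz, by simp⟩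
    · exact .inr ⟨σ, hσ, by simp⟩

variable [Fintype α]

theorem mem_leftWords {π z y : List α} (hπ : π ∈ deletions (K.p ++ [K.a]))
    (hz : z ∈ deletions (K.a' :: K.m')) (h : y ∈ substitutions (π ++ (K.m ++ K.c :: K.s)))
    (h' : y ∈ substitutions (K.p ++ (z ++ K.c' :: K.s))) : y ∈ K.leftWords := by
  have hπp : π.length = K.p.length := by simpa using length_of_mem_deletions hπ
  have hmz : K.m.length = z.length := by
    simpa [K.length_eq] using (length_of_mem_deletions hz).symm
  have hcs : K.c :: K.s ≠ K.c' :: K.s := by simp [K.ne_last]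
  simp only [leftWords, Finset.mem_union, Finset.mem_image, Finset.mem_univ, true_and,
    Finset.mem_filter, mem_prefixShifts]
  obtain ⟨rfl, w, hw, rfl⟩ | ⟨hmcs, -⟩ | ⟨hd, hd', rfl | rfl⟩ :=
    mem_substitutions_inter_append hπp h h'
  · rw [Finset.mem_inter] at hw
    obtain ⟨rfl, v, hv, rfl⟩ | ⟨hcs', -⟩ | ⟨hd, -, rfl | rfl⟩ :=
      mem_substitutions_inter_append hmz hw.1 hw.2
    · rw [Finset.mem_inter] at hv
      obtain ⟨hc, -⟩ | ⟨-, g, rfl⟩ | ⟨-, hs, -⟩ := mem_substitutions_inter_cons hv.1 hv.2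
      · exact absurd hc K.ne_last
      · exact .inl (.inl ⟨g, rfl⟩)
      · simp at hs
    · exact absurd hcs' hcs
    · exact .inl (.inl ⟨K.c', rfl⟩)
    · exact .inl (.inr ⟨z, ⟨hz, hd⟩, rfl⟩)
  · exact absurd (List.append_inj hmcs hmz).2 hcs
  · have hm : K.m = z := by
      rw [mismatches_append hmz, mismatches_cons, if_neg K.ne_last] at hd'
      exact (mismatches_eq_zero hmz).1 (by omega)
    exact .inr ⟨π, ⟨hπ, hd⟩, by rw [hm]⟩
  · exact .inl (.inl ⟨K.c, rfl⟩)

theorem mem_rightWords {z σ y : List α} (hz : z ∈ deletions (K.m ++ [K.c]))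
    (hσ : σ ∈ deletions (K.c' :: K.s)) (h : y ∈ substitutions (K.p ++ K.a :: (z ++ K.s)))
    (h' : y ∈ substitutions (K.p ++ K.a' :: (K.m' ++ σ))) : y ∈ K.rightWords := by
  refine Finset.mem_image.2 ⟨y.reverse, ?_, y.reverse_reverse⟩
  rw [← reverse_mem_deletions_reverse] at hz hσ
  rw [← reverse_mem_substitutions_reverse] at h h'
  exact mem_leftWords (π := σ.reverse) (z := z.reverse) (by simpa [mirror] using hσ)
    (by simpa [mirror] using hz) (by simpa [mirror] using h') (by simpa [mirror] using h)

theorem mem_cornerWords_of_mismatches_le_one {w : List α}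
    (hd : mismatches (K.m ++ [K.c]) (K.a' :: K.m') ≤ 1)
    (hw : w = (K.m ++ [K.c]) ++ K.s ∨ w = K.a' :: K.m' ++ K.s) : K.p ++ w ∈ K.cornerWords := by
  have hnear : K.p ++ (K.a' :: K.m' ++ K.s) ∈ substitutions (K.p ++ ((K.m ++ [K.c]) ++ K.s)) :=
    mem_substitutions_append.2 (.inr ⟨_, mem_substitutions_append.2
      (.inl ⟨_, mem_substitutions.2 ⟨length_middle_eq, hd⟩, rfl⟩), rfl⟩)
  simp only [cornerWords, Finset.mem_union, Finset.mem_inter]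
  obtain rfl | rfl := hw
  · exact .inl (.inl (.inl ⟨self_mem_substitutions _, mem_substitutions_comm.1 hnear⟩))
  · exact .inl (.inl (.inl ⟨hnear, self_mem_substitutions _⟩))

theorem append_mem_cornerWords {σ w : List α} (hσ : σ ∈ deletions (K.c' :: K.s))
    (h : w ∈ substitutions ((K.m ++ [K.c]) ++ K.s))
    (h' : w ∈ substitutions (K.a' :: K.m' ++ σ)) : K.p ++ w ∈ K.cornerWords := by
  have mem_of_mem_inter : w ∈ substitutions (K.a' :: K.m' ++ K.s) → K.p ++ w ∈ K.cornerWords := by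
    intro hs
    simp only [cornerWords, Finset.mem_union, Finset.mem_inter, mem_substitutions_append (u := K.p)]
    exact .inl (.inl (.inl ⟨.inr ⟨w, h, rfl⟩, .inr ⟨w, hs, rfl⟩⟩))
  obtain ⟨hmc, -⟩ | ⟨rfl, -⟩ | ⟨hd, hd', rfl | rfl⟩ :=
    mem_substitutions_inter_append length_middle_eq h h'
  · exact mem_of_mem_inter (hmc ▸ h)
  · exact mem_of_mem_inter h'
  · simp only [cornerWords, Finset.mem_union, Finset.mem_image, mem_suffixShifts]
    exact .inl (.inr ⟨σ, ⟨hσ, by rwa [mismatches_comm]⟩, rfl⟩)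
  · exact mem_cornerWords_of_mismatches_le_one hd.le (.inr rfl)

theorem mem_cornerWords {π σ y : List α} (hπ : π ∈ deletions (K.p ++ [K.a]))
    (hσ : σ ∈ deletions (K.c' :: K.s)) (h : y ∈ substitutions (π ++ ((K.m ++ [K.c]) ++ K.s)))
    (h' : y ∈ substitutions (K.p ++ (K.a' :: K.m' ++ σ))) : y ∈ K.cornerWords := by
  have hπp : π.length = K.p.length := by simpa using length_of_mem_deletions hπ
  have hσs : K.s.length = σ.length := by simpa using (length_of_mem_deletions hσ).symm
  obtain ⟨rfl, w, hw, rfl⟩ | ⟨hmcs, z, hz, rfl⟩ | ⟨hd, hd', rfl | rfl⟩ :=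
    mem_substitutions_inter_append hπp h h'
  · exact append_mem_cornerWords hσ (Finset.mem_inter.1 hw).1 (Finset.mem_inter.1 hw).2
  · obtain ⟨hmc, rfl⟩ := List.append_inj hmcs length_middle_eq
    simp only [cornerWords, Finset.mem_union, ← hmc, Finset.inter_self]
    exact .inl (.inl (.inl (mem_substitutions_append.2 (.inl ⟨z, (Finset.mem_inter.1 hz).2, rfl⟩))))
  · have hπ' : π ∈ prefixShifts K.p K.a := mem_prefixShifts.2 ⟨hπ, hd⟩
    rw [mismatches_append length_middle_eq] at hd'
    simp only [cornerWords, Finset.mem_union, Finset.mem_image]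
    by_cases hmc : K.IsShift
    · rw [hmc, mismatches_self, zero_add, mismatches_comm] at hd'
      refine .inr ?_
      rw [if_pos hmc]
      exact Finset.mem_image.2 ⟨(π, σ), Finset.mem_product.2
        ⟨hπ', mem_suffixShifts.2 ⟨hσ, hd'⟩⟩, rfl⟩
    · have := (mismatches_eq_zero length_middle_eq).not.2 hmc
      have hs : K.s = σ := (mismatches_eq_zero hσs).1 (by omega)
      exact .inl (.inl (.inr ⟨π, hπ', by rw [hs]⟩))
  · rw [mismatches_append length_middle_eq] at hd'
    exact mem_cornerWords_of_mismatches_le_one (by omega) (.inl rfl)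

theorem mem_leftWords_or_of_mem_deletions_prefix {π π' y : List α}
    (hπ : π ∈ deletions (K.p ++ [K.a])) (hπ' : π' ∈ deletions (K.p ++ [K.a']))
    (h : y ∈ substitutions (π ++ (K.m ++ K.c :: K.s)))
    (h' : y ∈ substitutions (π' ++ (K.m' ++ K.c' :: K.s))) :
    y ∈ K.leftWords ∨ y ∈ K.swap.leftWords ∨
    K.m = K.m' ∧ ∃ v ∈ deletions K.p, y = v ++ K.a :: (K.m ++ K.c' :: K.s) ∨
      y = v ++ K.a' :: (K.m ++ K.c :: K.s) := by
  obtain rfl | ⟨v, hv, rfl⟩ := mem_deletions_concat.1 hπ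
  · exact .inr (.inl (mem_leftWords (K := K.swap) hπ' (tail_mem_deletions_cons _ _) h' h))
  obtain rfl | ⟨v', hv', rfl⟩ := mem_deletions_concat.1 hπ'
  · exact .inl (mem_leftWords hπ (tail_mem_deletions_cons _ _) h h')
  refine .inr (.inr ?_)
  have hvv : v.length = v'.length := by
    simpa using (length_of_mem_deletions hv).trans (length_of_mem_deletions hv').symm
  have hcs : mismatches (K.m ++ K.c :: K.s) (K.m' ++ K.c' :: K.s) = mismatches K.m K.m' + 1 := by
    simp [mismatches_append K.length_eq, K.ne_last]
  simp only [List.append_assoc, List.singleton_append] at h h'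
  obtain ⟨rfl, w, hw, rfl⟩ | ⟨he, -⟩ | ⟨-, hd, -⟩ := mem_substitutions_inter_append hvv h h'
  · rw [Finset.mem_inter] at hw
    obtain ⟨ha, -⟩ | ⟨he, -⟩ | ⟨-, hd, hw⟩ := mem_substitutions_inter_cons hw.1 hw.2
    · exact absurd ha K.ne_first
    · simp [he] at hcs
    · have hm : K.m = K.m' := (mismatches_eq_zero K.length_eq).1 (by omega)
      refine ⟨hm, v, hv, ?_⟩
      simpa [hm] using hw
  · exact absurd (List.cons.inj he).1 K.ne_first
  · simp [hcs, K.ne_first] at hd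

theorem mem_parallelWords_of_mem_deletions_middle {z z' y : List α}
    (hz : z ∈ deletions K.m) (hz' : z' ∈ deletions K.m')
    (h : y ∈ substitutions (K.p ++ K.a :: (z ++ K.c :: K.s)))
    (h' : y ∈ substitutions (K.p ++ K.a' :: (z' ++ K.c' :: K.s))) : y ∈ K.parallelWords := by
  have hzz : z.length = z'.length := by
    have := length_of_mem_deletions hz
    have := length_of_mem_deletions hz'
    have := K.length_eq
    omega
  have hcs : mismatches (z ++ K.c :: K.s) (z' ++ K.c' :: K.s) = mismatches z z' + 1 := by
    simp [mismatches_append hzz, K.ne_last]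
  obtain ⟨-, w, hw, rfl⟩ | ⟨he, -⟩ | ⟨hd, -⟩ := mem_substitutions_inter_append rfl h h'
  · rw [Finset.mem_inter] at hw
    obtain ⟨ha, -⟩ | ⟨he, -⟩ | ⟨-, hd, hw⟩ := mem_substitutions_inter_cons hw.1 hw.2
    · exact absurd ha K.ne_first
    · simp [he] at hcs
    · obtain rfl : z = z' := (mismatches_eq_zero hzz).1 (by omega)
      simp only [parallelWords, hybridWords, Finset.mem_union, Finset.mem_image, Finset.mem_inter]
      obtain rfl | rfl := hw
      · exact .inl (.inr ⟨z, ⟨hz, hz'⟩, rfl⟩)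
      · exact .inr (.inr ⟨z, ⟨hz, hz'⟩, rfl⟩)
  · simp [(List.cons.inj he).2] at hcs
  · simp at hd

theorem mem_parallelWords_or_crossWords_of_mem_deletions_prefix {π π' y : List α}
    (hπ : π ∈ deletions (K.p ++ [K.a])) (hπ' : π' ∈ deletions (K.p ++ [K.a']))
    (h : y ∈ substitutions (π ++ (K.m ++ K.c :: K.s)))
    (h' : y ∈ substitutions (π' ++ (K.m' ++ K.c' :: K.s))) :
    y ∈ K.parallelWords ∪ K.crossWords ∪ K.swap.crossWords := by
  simp only [Finset.mem_union]
  obtain h | h | ⟨hm, v, hv, hy⟩ := mem_leftWords_or_of_mem_deletions_prefix hπ hπ' h h'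
  · exact .inl (.inr (by simp [crossWords, h]))
  · exact .inr (by simp [crossWords, h])
  · refine .inl (.inl ?_)
    simp only [parallelWords, hybridWords, if_pos hm, Finset.mem_union, Finset.mem_image]
    obtain rfl | rfl := hy
    · exact .inl (.inl (.inl ⟨v, hv, rfl⟩))
    · exact .inr (.inl (.inl ⟨v, hv, rfl⟩))

theorem mem_parallelWords_or_crossWords_of_mem_deletions_suffix {σ σ' y : List α}
    (hσ : σ ∈ deletions (K.c :: K.s)) (hσ' : σ' ∈ deletions (K.c' :: K.s))
    (h : y ∈ substitutions (K.p ++ K.a :: (K.m ++ σ)))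
    (h' : y ∈ substitutions (K.p ++ K.a' :: (K.m' ++ σ'))) :
    y ∈ K.parallelWords ∪ K.crossWords ∪ K.swap.crossWords := by
  rw [← reverse_mem_deletions_reverse] at hσ hσ'
  rw [← reverse_mem_substitutions_reverse] at h h'
  have of_mem_reverse : ∀ {L : SplitPair α}, y.reverse ∈ L.mirror.leftWords → y ∈ L.crossWords :=
    fun h => by
      simp only [crossWords, rightWords, Finset.mem_union, Finset.mem_image]
      exact .inl (.inr ⟨y.reverse, h, y.reverse_reverse⟩)
  simp only [Finset.mem_union]
  obtain h | h | ⟨hm, v, hv, hy⟩ := mem_leftWords_or_of_mem_deletions_prefix (K := K.mirror)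
    (π := σ'.reverse) (π' := σ.reverse) (y := y.reverse) (by simpa [mirror] using hσ')
    (by simpa [mirror] using hσ) (by simpa [mirror] using h') (by simpa [mirror] using h)
  · exact .inl (.inr (of_mem_reverse h))
  · exact .inr (of_mem_reverse h)
  · refine .inl (.inl ?_)
    have hm' : K.m = K.m' := by simpa [mirror, eq_comm] using hm
    rw [← reverse_mem_deletions_reverse] at hv
    simp only [parallelWords, hybridWords, if_pos hm', Finset.mem_union, Finset.mem_image]
    obtain hy | hy := hy <;> rw [List.reverse_eq_iff] at hy
    · exact .inl (.inl (.inr ⟨v.reverse, by simpa [mirror] using hv, by simp [hy, mirror, hm']⟩))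
    · exact .inr (.inl (.inr ⟨v.reverse, by simpa [mirror] using hv, by simp [hy, mirror, hm']⟩))

theorem delSubWords_inter_subset (K : SplitPair α) : delSubWords K.fst ∩ delSubWords K.snd ⊆
    K.parallelWords ∪ K.crossWords ∪ K.swap.crossWords := by
  intro y hy
  rw [Finset.mem_inter, mem_delSubWords, mem_delSubWords] at hy
  obtain ⟨⟨u, hu, h⟩, u', hu', h'⟩ := hy
  have of_cross : y ∈ K.leftWords ∨ y ∈ K.rightWords ∨ y ∈ K.cornerWords →
      y ∈ K.parallelWords ∪ K.crossWords ∪ K.swap.crossWords := by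
    simp only [crossWords, Finset.mem_union]
    tauto
  have of_swap_cross : y ∈ K.swap.leftWords ∨ y ∈ K.swap.rightWords ∨ y ∈ K.swap.cornerWords →
      y ∈ K.parallelWords ∪ K.crossWords ∪ K.swap.crossWords := by
    simp only [crossWords, Finset.mem_union]
    tauto
  obtain ⟨π, hπ, rfl⟩ | ⟨z, hz, rfl⟩ | ⟨σ, hσ, rfl⟩ := mem_deletions_fst hu <;>
    obtain ⟨π', hπ', rfl⟩ | ⟨z', hz', rfl⟩ | ⟨σ', hσ', rfl⟩ := mem_deletions_fst (K := K.swap) hu'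
  · exact mem_parallelWords_or_crossWords_of_mem_deletions_prefix hπ hπ' h h'
  · exact of_cross (.inl (mem_leftWords hπ (cons_mem_deletions_cons _ hz') h h'))
  · exact of_cross (.inr (.inr (mem_cornerWords hπ hσ' (by simpa using h) h')))
  · exact of_swap_cross (.inl (mem_leftWords hπ' (cons_mem_deletions_cons _ hz) h' h))
  · exact Finset.mem_union_left _ (Finset.mem_union_left _
      (mem_parallelWords_of_mem_deletions_middle hz hz' h h'))
  · exact of_cross (.inr (.inl (mem_rightWords
      (mem_deletions_concat.2 (.inr ⟨z, hz, rfl⟩)) hσ' (by simpa using h) h')))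
  · exact of_swap_cross (.inr (.inr (mem_cornerWords hπ' hσ (by simpa [swap] using h') h)))
  · exact of_swap_cross (.inr (.inl (mem_rightWords
      (mem_deletions_concat.2 (.inr ⟨z', hz', rfl⟩)) hσ (by simpa [swap] using h') h)))
  · exact mem_parallelWords_or_crossWords_of_mem_deletions_suffix hσ hσ' h h'

end Cover

section Bounds

variable {α : Type*} {K : SplitPair α}

theorem center_eq_of_isShift (hK : K.IsShift) :
    K.p ++ K.a' :: (K.m' ++ K.s) = K.p ++ (K.m ++ K.c :: K.s) := by
  simpa using congr_arg (K.p ++ · ++ K.s) hK.symm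

variable [DecidableEq α]

theorem card_hybridWords_le (K : SplitPair α) (g e : α) :
    (K.hybridWords g e).card ≤ K.p.length + K.m.length + K.s.length := by
  have hp := card_deletions_le K.p
  have hs := card_deletions_le K.s
  have hm : (deletions K.m ∩ deletions K.m').card ≤ K.m.length :=
    (Finset.card_le_card Finset.inter_subset_left).trans (card_deletions_le K.m)
  grw [hybridWords, Finset.card_union_le, Finset.card_image_le, hm]
  split_ifs
  · grw [Finset.card_union_le, Finset.card_image_le, Finset.card_image_le]
    omega
  · rw [Finset.card_empty]
    omega

theorem card_hybridWords_le_two (hm : K.m ≠ K.m') (g e : α) :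
    (K.hybridWords g e).card ≤ 2 := by
  rw [hybridWords, if_neg hm, Finset.empty_union]
  exact Finset.card_image_le.trans (card_deletions_inter_le_two hm)

theorem card_doubleShiftWords_le_one (K : SplitPair α) : K.doubleShiftWords.card ≤ 1 := by
  grw [doubleShiftWords, Finset.card_image_le, Finset.card_product, card_prefixShifts_le_one,
    card_suffixShifts_le_one]

theorem card_parallelWords_le (K : SplitPair α) :
    K.parallelWords.card ≤ 2 * (K.p.length + K.m.length + K.s.length) := by
  grw [parallelWords, Finset.card_union_le, card_hybridWords_le, card_hybridWords_le, two_mul]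

theorem card_parallelWords_le_four (hm : K.m ≠ K.m') : K.parallelWords.card ≤ 4 := by
  grw [parallelWords, Finset.card_union_le, card_hybridWords_le_two hm, card_hybridWords_le_two hm]

variable [Fintype α]

theorem card_leftWords_le (K : SplitPair α) : K.leftWords.card ≤ Fintype.card α + 4 := by
  grw [leftWords, Finset.card_union_le, Finset.card_union_le, Finset.card_image_le,
    Finset.card_image_le, Finset.card_image_le, Finset.card_univ,
    card_deletions_cons_filter_mismatches_eq_one_le K.a' K.length_eq, card_prefixShifts_le_one]

theorem card_rightWords_le (K : SplitPair α) : K.rightWords.card ≤ Fintype.card α + 4 :=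
  Finset.card_image_le.trans (card_leftWords_le K.mirror)

theorem card_cornerWords_le (hK : ¬K.IsShift) :
    K.cornerWords.card ≤ Fintype.card α + 2 := by
  have hq : 1 < Fintype.card α := Fintype.one_lt_card_iff.2 ⟨_, _, K.ne_first⟩
  have hl := length_middle_eq (K := K)
  have hne : K.p ++ ((K.m ++ [K.c]) ++ K.s) ≠ K.p ++ (K.a' :: K.m' ++ K.s) := fun h =>
    hK (List.append_inj (List.append_cancel_left h) hl).1
  have hS := card_substitutions_inter_le (by simp [K.length_eq, add_assoc]) hne
  grw [cornerWords, if_neg hK, Finset.union_empty, Finset.card_union_le, Finset.card_union_le, hS,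
    Finset.card_image_le, Finset.card_image_le, card_prefixShifts_le_one, card_suffixShifts_le_one]
  split_ifs <;> omega

theorem card_crossWords_le (hK : ¬K.IsShift) :
    K.crossWords.card ≤ 3 * Fintype.card α + 10 := by
  grw [crossWords, Finset.card_union_le, Finset.card_union_le, card_leftWords_le,
    card_rightWords_le, card_cornerWords_le hK]
  omega

theorem leftWords_subset (K : SplitPair α) : K.leftWords ⊆
    substitutions (K.p ++ (K.m ++ K.c :: K.s)) ∪
      (prefixShifts K.p K.a).image (· ++ (K.m ++ K.c' :: K.s)) := by
  refine Finset.union_subset_union_left (Finset.union_subset ?_ ?_) <;> intro y hy <;>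
    obtain ⟨z, hz, rfl⟩ := Finset.mem_image.1 hy <;>
    refine mem_substitutions_append.2 (.inr ⟨_, ?_, rfl⟩)
  · exact append_cons_mem_substitutions K.m z K.c K.s
  · rw [Finset.mem_filter] at hz
    have hmz : K.m.length = z.length := by
      simpa [K.length_eq] using (length_of_mem_deletions hz.1).symm
    exact mem_substitutions_append.2 (.inl ⟨z, mem_substitutions.2 ⟨hmz, hz.2.le⟩, rfl⟩)

theorem rightWords_subset (K : SplitPair α) : K.rightWords ⊆
    substitutions (K.p ++ K.a' :: (K.m' ++ K.s)) ∪
      (suffixShifts K.c' K.s).image (fun σ => K.p ++ K.a :: (K.m' ++ σ)) := by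
  intro y hy
  obtain ⟨w, hw, rfl⟩ := Finset.mem_image.1 hy
  obtain hy | hy := Finset.mem_union.1 (leftWords_subset K.mirror hw)
  · rw [← reverse_mem_substitutions_reverse] at hy
    exact Finset.mem_union_left _ (by simpa [mirror] using hy)
  · obtain ⟨π, hπ, rfl⟩ := Finset.mem_image.1 hy
    refine Finset.mem_union_right _ (Finset.mem_image.2 ⟨π.reverse, ?_, by simp [mirror]⟩)
    rw [← reverse_mem_prefixShifts_reverse, List.reverse_reverse]
    exact hπ

theorem cornerWords_subset_of_isShift (hK : K.IsShift) : K.cornerWords ⊆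
    substitutions (K.p ++ (K.m ++ K.c :: K.s)) ∪ K.doubleShiftWords := by
  have hprefix : (prefixShifts K.p K.a).image (· ++ (K.a' :: K.m' ++ K.s)) ⊆
      substitutions (K.p ++ (K.m ++ K.c :: K.s)) := by
    intro y hy
    obtain ⟨π, hπ, rfl⟩ := Finset.mem_image.1 hy
    rw [← center_eq_of_isShift hK]
    exact mem_substitutions_append.2 (.inl ⟨π, mem_substitutions_comm.1 (mem_substitutions.2
      ⟨length_of_mem_prefixShifts hπ, (mem_prefixShifts.1 hπ).2.le⟩), rfl⟩)
  have hsuffix : (suffixShifts K.c' K.s).image (fun σ => K.p ++ ((K.m ++ [K.c]) ++ σ)) ⊆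
      substitutions (K.p ++ (K.m ++ K.c :: K.s)) := by
    intro y hy
    obtain ⟨σ, hσ, rfl⟩ := Finset.mem_image.1 hy
    have := mem_substitutions_append (u := K.p ++ K.m ++ [K.c]).2 (.inr ⟨σ,
      mem_substitutions_comm.1 (mem_substitutions.2
        ⟨length_of_mem_suffixShifts hσ, (mem_suffixShifts.1 hσ).2.le⟩), rfl⟩)
    simpa using this
  have hinter : substitutions (K.p ++ ((K.m ++ [K.c]) ++ K.s)) ∩
      substitutions (K.p ++ (K.a' :: K.m' ++ K.s)) ⊆
      substitutions (K.p ++ (K.m ++ K.c :: K.s)) := by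
    rw [← List.append_cons]
    exact Finset.inter_subset_left
  rw [cornerWords, if_pos hK]
  exact Finset.union_subset_union_left
    (Finset.union_subset (Finset.union_subset hinter hprefix) hsuffix)

theorem crossWords_subset_of_isShift (hK : K.IsShift) : K.crossWords ⊆
    substitutions (K.p ++ (K.m ++ K.c :: K.s)) ∪
    (prefixShifts K.p K.a).image (· ++ (K.m ++ K.c' :: K.s)) ∪
    (suffixShifts K.c' K.s).image (fun σ => K.p ++ K.a :: (K.m' ++ σ)) ∪ K.doubleShiftWords := by
  have hright := rightWords_subset K
  rw [center_eq_of_isShift hK] at hright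
  intro y hy
  have hleft := @leftWords_subset _ _ _ K y
  have hright := @hright y
  have hcorner := @cornerWords_subset_of_isShift _ _ _ _ hK y
  simp only [crossWords, Finset.mem_union] at hy hleft hright hcorner ⊢
  tauto

theorem card_crossWords_le_of_isShift (hK : K.IsShift) : K.crossWords.card ≤
    4 + (K.p.length + K.m.length + K.s.length + 1) * (Fintype.card α - 1) := by
  grw [crossWords_subset_of_isShift hK, Finset.card_union_le, Finset.card_union_le,
    Finset.card_union_le, Finset.card_image_le, Finset.card_image_le, card_prefixShifts_le_one,
    card_suffixShifts_le_one, card_doubleShiftWords_le_one, card_substitutions]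
  apply le_of_eq
  simp only [List.length_append, List.length_cons]
  ring

end Bounds

end SplitPair

section FarDeletions

variable {α : Type*} [DecidableEq α]

/-- The words `v` obtained by deleting a symbol of `w` such that `w` and `g v` differ in at least
two positions. -/
def farDeletions (g : α) (w : List α) : Finset (List α) :=
  (deletions w).filter fun v => 2 ≤ mismatches w (g :: v)

theorem mem_farDeletions {g : α} {w v : List α} :
    v ∈ farDeletions g w ↔ v ∈ deletions w ∧ 2 ≤ mismatches w (g :: v) :=
  Finset.mem_filter

theorem farDeletions_cons (g c : α) (t : List α) : farDeletions g (c :: t) =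
    (deletions (c :: t)).filter
      (mismatches · t ∈ Finset.Icc (if c = g then 2 else 1) t.length) := by
  refine Finset.filter_congr fun v _ => ?_
  have := mismatches_le_length v t
  rw [mismatches_cons, mismatches_comm, Finset.mem_Icc]
  split_ifs <;> omega

theorem card_farDeletions_cons_le (g c : α) (t : List α) :
    (farDeletions g (c :: t)).card ≤ t.length + 1 - if c = g then 2 else 1 := by
  rw [farDeletions_cons, ← Nat.card_Icc]
  exact card_deletions_cons_filter_le c t _

theorem le_card_farDeletions_cons {c : α} {t : List α} (h : (c :: t).IsChain (· ≠ ·)) (g : α) :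
    t.length + 1 ≤ (farDeletions g (c :: t)).card + if c = g then 2 else 1 := by
  set k := if c = g then 2 else 1 with hk
  have hnear : ((deletions (c :: t)).filter (mismatches · t ∈ Finset.range k)).card ≤ k :=
    (card_deletions_cons_filter_le c t _).trans (Finset.card_range k).le
  have hsubset : deletions (c :: t) ⊆ farDeletions g (c :: t) ∪
      (deletions (c :: t)).filter (mismatches · t ∈ Finset.range k) := by
    intro v hv
    have := mismatches_le_length v t
    simp only [farDeletions_cons, ← hk, Finset.mem_union, Finset.mem_filter, hv, true_and,
      Finset.mem_Icc, Finset.mem_range]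
    omega
  calc t.length + 1 = (deletions (c :: t)).card := (card_deletions_of_isChain h).symm
    _ ≤ _ := (Finset.card_le_card hsubset).trans (Finset.card_union_le _ _)
    _ ≤ _ := Nat.add_le_add_left hnear _

theorem card_farDeletions_add_card_le [Fintype α] {a b : α} (hab : a ≠ b) (w : List α) :
    (farDeletions a w).card + (farDeletions b w).card ≤
      2 * w.length - (2 + if Fintype.card α = 2 then 1 else 0) := by
  cases w with
  | nil => simp [farDeletions]
  | cons c t =>
    have head_of_card_eq_two : Fintype.card α = 2 → c = a ∨ c = b := by
      intro hα
      by_contra! hc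
      have := Finset.card_le_univ {c, a, b}
      rw [Finset.card_eq_three.2 ⟨c, a, b, hc.1, hc.2, hab, rfl⟩] at this
      omega
    grw [card_farDeletions_cons_le, card_farDeletions_cons_le, List.length_cons]
    split_ifs <;> grind

end FarDeletions

section Transpositions

variable {α : Type*}

/-- The words `p a b s` and `p b a s`. -/
def SplitPair.transposition (p : List α) {a b : α} (hab : a ≠ b) (s : List α) : SplitPair α :=
  ⟨p, a, b, [], [], b, a, s, hab, hab.symm, rfl⟩

open SplitPair

theorem SplitPair.isShift_transposition (p : List α) {a b : α} (hab : a ≠ b) (s : List α) :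
    (transposition p hab s).IsShift :=
  rfl

theorem SplitPair.eq_transposition {K : SplitPair α} (hK : K.IsShift) (hK' : K.swap.IsShift)
    (hm : K.m = K.m') : K = transposition K.p K.ne_first K.s := by
  cases K with
  | mk p a a' m m' c c' s ha hc _ =>
    obtain rfl : m = m' := hm
    replace hK : m ++ [c] = a' :: m := hK
    replace hK' : m ++ [c'] = a :: m := hK'
    cases m with
    | nil =>
      obtain rfl : c = a' := by simpa using hK
      obtain rfl : c' = a := by simpa using hK'
      rfl
    | cons g m => exact absurd ((List.cons.inj hK').1.symm.trans (List.cons.inj hK).1) ha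

variable [DecidableEq α]

theorem SplitPair.card_doubleShiftWords_transposition_le (p : List α) {a b : α} (hab : a ≠ b)
    (s : List α) :
    (transposition p hab s).doubleShiftWords.card ≤ if p = [] ∨ s = [] then 0 else 1 := by
  split_ifs with h
  · obtain rfl | rfl := h <;> simp [doubleShiftWords, transposition]
  · exact card_doubleShiftWords_le_one _

/-- The words `p g g v` and `v g g s` which differ from `p g s` in at least two positions, where `v`
arises by deleting a symbol of `s` or of `p`. -/
def repeatWords (p : List α) (g : α) (s : List α) : Finset (List α) :=
  (farDeletions g s).image (fun v => p ++ g :: g :: v) ∪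
  (farDeletions g p.reverse).image (fun v => v.reverse ++ g :: g :: s)

theorem card_repeatWords_le (p : List α) (g : α) (s : List α) :
    (repeatWords p g s).card ≤ (farDeletions g s).card + (farDeletions g p.reverse).card :=
  (Finset.card_union_le _ _).trans (Nat.add_le_add Finset.card_image_le Finset.card_image_le)

variable [Fintype α]

/-- The words obtained from `p b s` or `p a s` by substituting at most one symbol; `p b s` and
`p a s` arise from `p a b s` by deleting one of the two transposed symbols. -/
def swapBalls (p : List α) (a b : α) (s : List α) : Finset (List α) :=
  substitutions (p ++ b :: s) ∪ substitutions (p ++ a :: s)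

theorem card_swapBalls (p : List α) {a b : α} (hab : a ≠ b) (s : List α) :
    (swapBalls p a b s).card + Fintype.card α =
      2 * (1 + (p.length + s.length + 1) * (Fintype.card α - 1)) := by
  have hinter : substitutions (p ++ b :: s) ∩ substitutions (p ++ a :: s) =
      Finset.univ.image (fun g => p ++ g :: s) := by
    apply Finset.Subset.antisymm
    · intro y hy
      rw [Finset.mem_inter] at hy
      obtain ⟨-, w, hw, rfl⟩ | ⟨h, -⟩ | ⟨h, -⟩ := mem_substitutions_inter_append rfl hy.1 hy.2
      · rw [Finset.mem_inter] at hw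
        obtain ⟨h, -⟩ | ⟨-, g, rfl⟩ | ⟨-, h, -⟩ := mem_substitutions_inter_cons hw.1 hw.2
        · exact absurd h hab.symm
        · exact Finset.mem_image_of_mem _ (Finset.mem_univ g)
        · simp at h
      · exact absurd (List.cons.inj h).1 hab.symm
      · simp at h
    · intro y hy
      obtain ⟨g, -, rfl⟩ := Finset.mem_image.1 hy
      simp [append_cons_mem_substitutions]
  have hcard := Finset.card_union_add_card_inter (substitutions (p ++ b :: s))
    (substitutions (p ++ a :: s))
  rw [hinter, Finset.card_image_of_injective _ (fun g g' h => by simpa using h), Finset.card_univ,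
    card_substitutions, card_substitutions] at hcard
  rw [swapBalls, hcard]
  simp only [List.length_append, List.length_cons]
  ring

theorem crossWords_transposition_subset (p : List α) {a b : α} (hab : a ≠ b) (s : List α) :
    (transposition p hab s).crossWords ⊆ substitutions (p ++ b :: s) ∪
      (transposition p hab s).hybridWords a a ∪ (transposition p hab s).doubleShiftWords := by
  have hprefix : (prefixShifts p a).image (· ++ a :: s) ⊆
      (transposition p hab s).hybridWords a a := by
    intro y hy
    obtain ⟨π, hπ, rfl⟩ := Finset.mem_image.1 hy
    obtain ⟨hπ, hdist⟩ := mem_prefixShifts.1 hπ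
    obtain rfl | ⟨v, hv, rfl⟩ := mem_deletions_concat.1 hπ
    · simp at hdist
    · simpa [transposition, hybridWords] using Or.inl hv
  have hsuffix : (suffixShifts a s).image (fun σ => p ++ a :: σ) ⊆
      (transposition p hab s).hybridWords a a := by
    intro y hy
    obtain ⟨σ, hσ, rfl⟩ := Finset.mem_image.1 hy
    obtain ⟨hσ, hdist⟩ := mem_suffixShifts.1 hσ
    obtain rfl | ⟨v, hv, rfl⟩ := mem_deletions_cons.1 hσ
    · simp at hdist
    · simpa [transposition, hybridWords] using Or.inr hv
  intro y hy
  have := crossWords_subset_of_isShift (isShift_transposition p hab s) hy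
  have hprefix := @hprefix y
  have hsuffix := @hsuffix y
  simp only [Finset.mem_union] at this ⊢
  tauto

theorem hybridWords_transposition_subset (p : List α) {a b : α} (hab : a ≠ b) (s : List α)
    (g : α) : (transposition p hab s).hybridWords g g ⊆
      substitutions (p ++ g :: s) ∪ repeatWords p g s := by
  have hprefix : ∀ v ∈ deletions p,
      v ++ g :: g :: s ∈ substitutions (p ++ g :: s) ∪ repeatWords p g s := by
    intro v hv
    have hv' := reverse_mem_deletions_reverse.2 hv
    by_cases hfar : v.reverse ∈ farDeletions g p.reverse
    · exact Finset.mem_union_right _ (Finset.mem_union_right _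
        (Finset.mem_image.2 ⟨v.reverse, hfar, by rw [List.reverse_reverse]⟩))
    · have hl : p.length = (v ++ [g]).length := by simpa using (length_of_mem_deletions hv).symm
      rw [mem_farDeletions, ← List.reverse_concat, mismatches_reverse hl] at hfar
      refine Finset.mem_union_left _ (mem_substitutions_append.2 (.inl
        ⟨v ++ [g], mem_substitutions.2 ⟨hl, ?_⟩, by simp⟩))
      grind
  have hsuffix : ∀ v ∈ deletions s,
      p ++ g :: g :: v ∈ substitutions (p ++ g :: s) ∪ repeatWords p g s := by
    intro v hv
    by_cases hfar : v ∈ farDeletions g s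
    · exact Finset.mem_union_right _ (Finset.mem_union_left _ (Finset.mem_image_of_mem _ hfar))
    · have hl : s.length = (g :: v).length := (length_of_mem_deletions hv).symm
      rw [mem_farDeletions] at hfar
      refine Finset.mem_union_left _ (mem_substitutions.2 ⟨by simp [hl], ?_⟩)
      rw [mismatches_append_left, mismatches_cons]
      grind
  intro y hy
  obtain ⟨v, hv, rfl⟩ | ⟨v, hv, rfl⟩ : (∃ v ∈ deletions p, v ++ g :: g :: s = y) ∨
      ∃ v ∈ deletions s, p ++ g :: g :: v = y := by
    simpa [transposition, hybridWords] using hy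
  exacts [hprefix v hv, hsuffix v hv]

theorem delSubWords_inter_transposition_subset (p : List α) {a b : α} (hab : a ≠ b)
    (s : List α) :
    delSubWords (transposition p hab s).fst ∩ delSubWords (transposition p hab s).snd ⊆
      swapBalls p a b s ∪ (repeatWords p a s ∪ repeatWords p b s) ∪
      ((transposition p hab s).doubleShiftWords ∪
        (transposition p hab.symm s).doubleShiftWords) := by
  intro y hy
  have hcover := delSubWords_inter_subset (transposition p hab s) hy
  have hcross := @crossWords_transposition_subset _ _ _ p _ _ hab s y
  have hcross' := @crossWords_transposition_subset _ _ _ p _ _ hab.symm s y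
  have hybrid (g : α) := @hybridWords_transposition_subset _ _ _ p _ _ hab s g y
  have hybrid' := @hybridWords_transposition_subset _ _ _ p _ _ hab.symm s b y
  change y ∈ (transposition p hab s).hybridWords a a ∪ (transposition p hab s).hybridWords b b ∪
    (transposition p hab s).crossWords ∪ (transposition p hab.symm s).crossWords at hcover
  simp only [swapBalls, Finset.mem_union] at *
  grind

theorem card_delSubWords_inter_transposition_le (p : List α) {a b : α} (hab : a ≠ b) (s : List α)
    (hl : 3 ≤ p.length + s.length) :
    (delSubWords (transposition p hab s).fst ∩ delSubWords (transposition p hab s).snd).card +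
        Fintype.card α + (2 + if Fintype.card α = 2 then 1 else 0) ≤
      2 * (1 + (p.length + s.length + 1) * (Fintype.card α - 1)) +
        2 * (p.length + s.length) := by
  have hcover := Finset.card_le_card (delSubWords_inter_transposition_subset p hab s)
  grw [Finset.card_union_le, Finset.card_union_le, Finset.card_union_le, Finset.card_union_le,
    card_repeatWords_le, card_repeatWords_le, card_doubleShiftWords_transposition_le,
    card_doubleShiftWords_transposition_le] at hcover
  have hs := card_farDeletions_add_card_le hab s
  have hp := card_farDeletions_add_card_le hab p.reverse
  rw [List.length_reverse] at hp
  rw [← card_swapBalls p hab s]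
  simp only [← List.length_eq_zero_iff] at hcover
  split_ifs at hcover hs hp ⊢ <;> omega

end Transpositions

section UpperBound

variable {α : Type*}

theorem exists_first_ne {x x' : List α} (hl : x.length = x'.length) (hne : x ≠ x') :
    ∃ p a a' u u', a ≠ a' ∧ u.length = u'.length ∧ x = p ++ a :: u ∧ x' = p ++ a' :: u' := by
  induction x generalizing x' with
  | nil => exact absurd (List.eq_nil_of_length_eq_zero hl.symm).symm hne
  | cons a x ih =>
    obtain ⟨a', x', rfl⟩ := List.exists_cons_of_length_eq_add_one hl.symm
    have hl : x.length = x'.length := by simpa using hl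
    by_cases ha : a = a'
    · obtain ⟨p, b, b', u, u', hb, hu, rfl, rfl⟩ := ih hl (by simpa [ha] using hne)
      exact ⟨a :: p, b, b', u, u', hb, hu, rfl, by rw [ha, List.cons_append]⟩
    · exact ⟨[], a, a', x, x', ha, hl, rfl, rfl⟩

theorem exists_last_ne {x x' : List α} (hl : x.length = x'.length) (hne : x ≠ x') :
    ∃ m m' c c' s, c ≠ c' ∧ m.length = m'.length ∧ x = m ++ c :: s ∧ x' = m' ++ c' :: s := by
  obtain ⟨p, c, c', u, u', hc, hu, h, h'⟩ :=
    exists_first_ne (x := x.reverse) (x' := x'.reverse) (by simpa) (by simpa)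
  rw [List.reverse_eq_iff] at h h'
  exact ⟨u.reverse, u'.reverse, c, c', p.reverse, hc, by simpa, by simp [h], by simp [h']⟩

variable [DecidableEq α]

theorem SplitPair.exists_of_two_le_mismatches {x x' : List α} (hl : x.length = x'.length)
    (hx : 2 ≤ mismatches x x') : ∃ K : SplitPair α, x = K.fst ∧ x' = K.snd := by
  obtain ⟨p, a, a', u, u', ha, hu, rfl, rfl⟩ := exists_first_ne hl (by rintro rfl; simp at hx)
  rw [mismatches_append_left, mismatches_cons, if_neg ha] at hx
  obtain ⟨m, m', c, c', s, hc, hm, rfl, rfl⟩ := exists_last_ne hu (by rintro rfl; simp at hx)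
  exact ⟨⟨p, a, a', m, m', c, c', s, ha, hc, hm⟩, rfl, rfl⟩

variable [Fintype α]

theorem SplitPair.card_delSubWords_inter_le (K : SplitPair α)
    (hn : Fintype.card α + 16 ≤ 2 * K.fst.length)
    (hn' : 5 * Fintype.card α + 14 ≤ (Fintype.card α - 1) * K.fst.length) :
    (delSubWords K.fst ∩ delSubWords K.snd).card + 3 * Fintype.card α + 2 +
      (if Fintype.card α = 2 then 1 else 0) ≤ 2 * Fintype.card α * K.fst.length := by
  have hlen : K.fst.length = K.p.length + K.m.length + K.s.length + 2 := by
    simp only [fst, List.length_append, List.length_cons]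
    ring
  have hcover := (Finset.card_le_card (delSubWords_inter_subset K)).trans
    (Finset.card_union_le _ _)
  grw [Finset.card_union_le] at hcover
  have hparallel := card_parallelWords_le K
  have hq : 1 < Fintype.card α := Fintype.one_lt_card_iff.2 ⟨_, _, K.ne_first⟩
  obtain ⟨r, hr⟩ : ∃ r, Fintype.card α = r + 1 := Nat.exists_eq_add_one.2 (by omega)
  have hball : (K.p.length + K.m.length + K.s.length + 1) * (Fintype.card α - 1) + r =
      r * K.fst.length := by
    rw [hlen, hr, Nat.add_sub_cancel]
    ring
  have hmul : 2 * Fintype.card α * K.fst.length = 2 * (r * K.fst.length) + 2 * K.fst.length := by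
    rw [hr]
    ring
  have hswap : K.swap.p.length + K.swap.m.length + K.swap.s.length =
      K.p.length + K.m.length + K.s.length := by
    simp only [swap, K.length_eq]
  by_cases hK : K.IsShift <;> by_cases hK' : K.swap.IsShift
  · by_cases hm : K.m = K.m'
    · have hm_nil : K.m = [] := congr_arg SplitPair.m (eq_transposition hK hK' hm)
      have h := card_delSubWords_inter_transposition_le K.p K.ne_first K.s
      rw [← eq_transposition hK hK' hm] at h
      simp only [hm_nil, List.length_nil, add_zero] at hball hlen
      grind
    · have h := card_crossWords_le_of_isShift hK
      have h' := card_crossWords_le_of_isShift hK'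
      have hparallel := card_parallelWords_le_four hm
      rw [hswap] at h'
      grind
  · have h := card_crossWords_le_of_isShift hK
    have h' := card_crossWords_le hK'
    grind
  · have h := card_crossWords_le hK
    have h' := card_crossWords_le_of_isShift hK'
    grind
  · have h := card_crossWords_le hK
    have h' := card_crossWords_le hK'
    grind

theorem card_delSubWords_inter_le {x x' : List α} (hl : x.length = x'.length)
    (hx : 2 ≤ mismatches x x')
    (hn : Fintype.card α + 16 ≤ 2 * x.length)
    (hn' : 5 * Fintype.card α + 14 ≤ (Fintype.card α - 1) * x.length) :
    (delSubWords x ∩ delSubWords x').card + 3 * Fintype.card α + 2 +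
      (if Fintype.card α = 2 then 1 else 0) ≤ 2 * Fintype.card α * x.length := by
  obtain ⟨K, rfl, rfl⟩ := SplitPair.exists_of_two_le_mismatches hl hx
  exact K.card_delSubWords_inter_le hn hn'

end UpperBound

section LowerBound

variable {α : Type*} [DecidableEq α]

theorem repeatWords_nil_left (g : α) (s : List α) :
    repeatWords [] g s = (farDeletions g s).image (fun v => g :: g :: v) := by
  simp [repeatWords, farDeletions]

theorem disjoint_repeatWords {a b : α} (hab : a ≠ b) (s : List α) :
    Disjoint (repeatWords [] a s) (repeatWords [] b s) := by
  refine Finset.disjoint_right.2 fun y hy hy' => ?_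
  rw [repeatWords_nil_left, Finset.mem_image] at hy hy'
  obtain ⟨v, -, rfl⟩ := hy
  obtain ⟨w, -, h⟩ := hy'
  exact hab (List.cons.inj h).1

theorem le_card_repeatWords {c : α} {t : List α} (h : (c :: t).IsChain (· ≠ ·)) (g : α) :
    t.length + 1 ≤ (repeatWords [] g (c :: t)).card + if c = g then 2 else 1 := by
  rw [repeatWords_nil_left, Finset.card_image_of_injective _ fun v w hvw => by simpa using hvw]
  exact le_card_farDeletions_cons h g

variable [Fintype α]

theorem subset_delSubWords_transposition (p : List α) (a b : α) (s : List α) :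
    swapBalls p a b s ∪ (repeatWords p a s ∪ repeatWords p b s) ⊆
      delSubWords (p ++ a :: b :: s) := by
  have hswap : swapBalls p a b s ⊆ delSubWords (p ++ a :: b :: s) := by
    refine Finset.union_subset ?_ ?_ <;>
      refine Finset.subset_biUnion_of_mem substitutions (mem_deletions_append.2 (.inr ⟨_, ?_, rfl⟩))
    · exact tail_mem_deletions_cons _ _
    · exact cons_mem_deletions_cons a (tail_mem_deletions_cons b s)
  have hrepeat {g : α} {u v : List α} (hg : g = a ∨ g = b)
      (huv : u ++ a :: b :: v ∈ deletions (p ++ a :: b :: s)) :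
      u ++ g :: g :: v ∈ delSubWords (p ++ a :: b :: s) := by
    refine mem_delSubWords.2 ⟨_, huv, ?_⟩
    obtain rfl | rfl := hg
    · simpa using append_cons_mem_substitutions (u ++ [g]) g b v
    · exact append_cons_mem_substitutions u g a (g :: v)
  have hrepeatWords {g : α} (hg : g = a ∨ g = b) :
      repeatWords p g s ⊆ delSubWords (p ++ a :: b :: s) := by
    refine Finset.union_subset ?_ ?_ <;> intro y hy <;> obtain ⟨v, hv, rfl⟩ := Finset.mem_image.1 hy
    · exact hrepeat hg (mem_deletions_append.2 (.inr ⟨_, cons_mem_deletions_cons a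
        (cons_mem_deletions_cons b (mem_farDeletions.1 hv).1), rfl⟩))
    · refine hrepeat hg (mem_deletions_append.2 (.inl ⟨_, ?_, rfl⟩))
      rw [← reverse_mem_deletions_reverse, List.reverse_reverse]
      exact (mem_farDeletions.1 hv).1
  exact Finset.union_subset hswap
    (Finset.union_subset (hrepeatWords (.inl rfl)) (hrepeatWords (.inr rfl)))

theorem subset_delSubWords_inter_transposition (p : List α) (a b : α) (s : List α) :
    swapBalls p a b s ∪ (repeatWords p a s ∪ repeatWords p b s) ⊆
      delSubWords (p ++ a :: b :: s) ∩ delSubWords (p ++ b :: a :: s) := by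
  refine Finset.subset_inter (subset_delSubWords_transposition p a b s) ?_
  have := subset_delSubWords_transposition p b a s
  rwa [swapBalls, Finset.union_comm (substitutions _), Finset.union_comm (repeatWords _ _ _)]
    at this

theorem disjoint_swapBalls_repeatWords (a b g : α) (s : List α) :
    Disjoint (swapBalls [] a b s) (repeatWords [] g s) := by
  refine Finset.disjoint_right.2 fun y hy hy' => ?_
  rw [repeatWords_nil_left, Finset.mem_image] at hy
  obtain ⟨v, hv, rfl⟩ := hy
  have := (mem_farDeletions.1 hv).2
  simp only [swapBalls, Finset.mem_union, mem_substitutions, List.nil_append] at hy'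
  rw [mismatches_cons _ g, mismatches_cons _ g] at hy'
  omega

theorem le_card_delSubWords_inter_transposition {a b c : α} (hab : a ≠ b) {t : List α}
    (h : (c :: t).IsChain (· ≠ ·)) :
    2 * (1 + (t.length + 2) * (Fintype.card α - 1)) + 2 * (t.length + 1) ≤
      (delSubWords (a :: b :: c :: t) ∩ delSubWords (b :: a :: c :: t)).card + Fintype.card α +
        (2 + if c = a ∨ c = b then 1 else 0) := by
  have hsubset := Finset.card_le_card (subset_delSubWords_inter_transposition [] a b (c :: t))
  rw [Finset.card_union_of_disjoint (Finset.disjoint_union_right.2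
    ⟨disjoint_swapBalls_repeatWords a b a _, disjoint_swapBalls_repeatWords a b b _⟩),
    Finset.card_union_of_disjoint (disjoint_repeatWords hab _)] at hsubset
  have hswap := card_swapBalls [] hab (c :: t)
  have ha := le_card_repeatWords h a
  have hb := le_card_repeatWords h b
  simp only [List.nil_append, List.length_nil, List.length_cons, zero_add, add_assoc,
    Nat.reduceAdd] at hsubset hswap
  grind

end LowerBound

section Functions

variable {α : Type*}

theorem ofFn_alternating_succ (a b : α) (k : ℕ) :
    List.ofFn (alternating a b (k + 1)) = a :: List.ofFn (alternating b a k) := by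
  rw [List.ofFn_succ]
  congr 2
  ext i
  simp only [alternating, Fin.val_succ]
  split_ifs <;> first | rfl | omega

theorem isChain_cons_ofFn_alternating {a b c : α} (hca : c ≠ a) (hab : a ≠ b) (k : ℕ) :
    (c :: List.ofFn (alternating a b k)).IsChain (· ≠ ·) := by
  induction k generalizing a b c with
  | zero => simp
  | succ k ih =>
    rw [ofFn_alternating_succ]
    exact List.IsChain.cons_cons hca (ih hab hab.symm)

variable [DecidableEq α]

theorem hammingDist_eq_mismatches {n : ℕ} (x y : Fin n → α) :
    hammingDist x y = mismatches (List.ofFn x) (List.ofFn y) := by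
  induction n with
  | zero => simp [hammingDist]
  | succ n ih =>
    rw [List.ofFn_succ, List.ofFn_succ, mismatches_cons, ← ih, hammingDist, hammingDist,
      Fin.card_filter_univ_succ]
    by_cases h : x 0 = y 0 <;> simp [h, add_comm]

theorem mem_deletions_ofFn {n : ℕ} (hn : 1 ≤ n) {x : Fin n → α} {u : List α} :
    u ∈ deletions (List.ofFn x) ↔ ∃ D : Fin (n - 1) ↪o Fin n, u = List.ofFn (x ∘ D) := by
  rw [mem_deletions_iff_sublist, List.sublist_iff_exists_fin_orderEmbedding_get_eq]
  constructor
  · rintro ⟨⟨f, hf⟩, hl⟩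
    have hl : n - 1 = u.length := by
      rw [List.length_ofFn] at hl
      omega
    refine ⟨((Fin.castOrderIso hl).toOrderEmbedding.trans f).trans
      (Fin.castOrderIso List.length_ofFn).toOrderEmbedding,
      List.ext_get (by simp [hl]) fun i h _ => ?_⟩
    simpa [Fin.cast] using hf ⟨i, h⟩
  · rintro ⟨D, rfl⟩
    refine ⟨⟨((Fin.castOrderIso List.length_ofFn).toOrderEmbedding.trans D).trans
      (Fin.castOrderIso List.length_ofFn.symm).toOrderEmbedding, fun i => ?_⟩, ?_⟩
    · simp [Fin.cast]
    · rw [List.length_ofFn, List.length_ofFn]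
      omega

variable [Fintype α]

theorem mem_delSubBall_iff {n : ℕ} (hn : 1 ≤ n) {x : Fin n → α} {y : Fin (n - 1) → α} :
    y ∈ delSubBall 1 1 x ↔ List.ofFn y ∈ delSubWords (List.ofFn x) := by
  simp [delSubBall, mem_delSubWords, mem_deletions_ofFn hn, mem_substitutions,
    hammingDist_eq_mismatches]

theorem ncard_delSubBall_inter {n : ℕ} (hn : 1 ≤ n) (x x' : Fin n → α) :
    (delSubBall 1 1 x ∩ delSubBall 1 1 x').ncard =
      (delSubWords (List.ofFn x) ∩ delSubWords (List.ofFn x')).card := by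
  rw [← Set.ncard_image_of_injective _ (List.ofFn_injective (α := α) (n := n - 1)),
    ← Set.ncard_coe_finset]
  congr 1
  ext u
  simp only [Set.mem_image, Set.mem_inter_iff, mem_delSubBall_iff hn, Finset.mem_coe,
    Finset.mem_inter]
  constructor
  · rintro ⟨y, hy, rfl⟩
    exact hy
  · intro hu
    obtain ⟨v, hv, huv⟩ := mem_delSubWords.1 hu.1
    have hl : n - 1 = u.length := by
      have := length_of_mem_deletions hv
      rw [List.length_ofFn, length_of_mem_substitutions huv] at this
      omega
    have hofFn : List.ofFn (fun i => u.get (i.cast hl)) = u := by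
      rw [← List.ofFn_congr hl.symm, List.ofFn_get]
    exact ⟨_, by rwa [hofFn], hofFn⟩

theorem ncard_delSubBall_inter_le {n : ℕ} (hn : Fintype.card α + 16 ≤ 2 * n)
    (hn' : 5 * Fintype.card α + 14 ≤ (Fintype.card α - 1) * n) {x x' : Fin n → α}
    (hx : 2 ≤ hammingDist x x') :
    ((delSubBall 1 1 x ∩ delSubBall 1 1 x').ncard : ℤ) ≤
      2 * Fintype.card α * n - 3 * Fintype.card α - 2 -
        (if Fintype.card α = 2 then 1 else 0) := by
  have h := card_delSubWords_inter_le (x := List.ofFn x) (x' := List.ofFn x') (by simp)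
    (by rwa [← hammingDist_eq_mismatches]) (by simpa using hn) (by simpa using hn')
  rw [← ncard_delSubBall_inter (by omega), List.length_ofFn, ← Nat.cast_le (α := ℤ)] at h
  push_cast at h
  linarith

theorem ncard_delSubBall_inter_transposition {n : ℕ} (hn : Fintype.card α + 16 ≤ 2 * n)
    (hn' : 5 * Fintype.card α + 14 ≤ (Fintype.card α - 1) * n) {x x' : Fin n → α}
    {a b c : α} {t : List α} (hab : a ≠ b) (hc : c = a ∨ c = b → Fintype.card α = 2)
    (hx : List.ofFn x = a :: b :: c :: t) (hx' : List.ofFn x' = b :: a :: c :: t)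
    (ht : (c :: t).IsChain (· ≠ ·)) :
    hammingDist x x' = 2 ∧ ((delSubBall 1 1 x ∩ delSubBall 1 1 x').ncard : ℤ) =
      2 * Fintype.card α * n - 3 * Fintype.card α - 2 -
        (if Fintype.card α = 2 then 1 else 0) := by
  have hdist : hammingDist x x' = 2 := by
    simp [hammingDist_eq_mismatches, hx, hx', hab, hab.symm]
  refine ⟨hdist, le_antisymm (ncard_delSubBall_inter_le hn hn' hdist.ge) ?_⟩
  have hlen : n = t.length + 3 := by simpa using congr_arg List.length hx
  have hq : 1 < Fintype.card α := Fintype.one_lt_card_iff.2 ⟨a, b, hab⟩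
  have h := le_card_delSubWords_inter_transposition hab ht
  rw [← hx, ← hx', ← ncard_delSubBall_inter (by omega)] at h
  have hδ : (if c = a ∨ c = b then 1 else 0 : ℤ) ≤ if Fintype.card α = 2 then 1 else 0 := by
    split_ifs <;> grind
  rw [← Nat.cast_le (α := ℤ)] at h
  push_cast [hq.le] at h
  rw [show (n : ℤ) = t.length + 3 from mod_cast hlen]
  linarith

theorem exists_ncard_delSubBall_inter_eq {n : ℕ} (hn : Fintype.card α + 16 ≤ 2 * n)
    (hn' : 5 * Fintype.card α + 14 ≤ (Fintype.card α - 1) * n) :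
    ∃ x x' : Fin n → α, hammingDist x x' = 2 ∧
      ((delSubBall 1 1 x ∩ delSubBall 1 1 x').ncard : ℤ) =
        2 * Fintype.card α * n - 3 * Fintype.card α - 2 -
          (if Fintype.card α = 2 then 1 else 0) := by
  obtain ⟨a, b, c, hab, hca, hcb⟩ :
      ∃ a b c : α, a ≠ b ∧ c ≠ a ∧ (c = b → Fintype.card α = 2) := by
    have hq : 1 < Fintype.card α := by
      by_contra! h
      rw [Nat.sub_eq_zero_of_le h] at hn'
      omega
    obtain hq | hq := (Nat.succ_le_of_lt hq).eq_or_lt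
    · obtain ⟨a, b, hab⟩ := Fintype.one_lt_card_iff.1 hq.le
      exact ⟨a, b, b, hab, hab.symm, fun _ => hq.symm⟩
    · obtain ⟨a, b, c, hab, hac, hbc⟩ := Fintype.two_lt_card_iff.1 hq
      exact ⟨a, b, c, hab, hac.symm, fun h => absurd h.symm hbc⟩
  obtain ⟨k, rfl⟩ : ∃ k, n = k + 3 := ⟨n - 3, by omega⟩
  exact ⟨Fin.cons a (Fin.cons b (Fin.cons c (alternating a b k))),
    Fin.cons b (Fin.cons a (Fin.cons c (alternating a b k))),
    ncard_delSubBall_inter_transposition hn hn' hab (fun h => hcb (h.resolve_left hca))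
      (by simp) (by simp) (isChain_cons_ofFn_alternating hca hab k)⟩

end Functions

theorem theorem1_general (q n : ℕ) [NeZero q] (hq : 2 ≤ q)
    (hn : max (((q : ℝ) + 16) / 2) ((5 * (q : ℝ) + 14) / ((q : ℝ) - 1)) ≤ (n : ℝ)) :
    (∀ x x' : Fin n → Fin q, 2 ≤ hammingDist x x' →
      ((delSubBall 1 1 x ∩ delSubBall 1 1 x').ncard : ℤ) ≤
        2 * q * n - 3 * q - 2 - (if q = 2 then 1 else 0)) ∧
    (∃ x x' : Fin n → Fin q, hammingDist x x' = 2 ∧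
      ((delSubBall 1 1 x ∩ delSubBall 1 1 x').ncard : ℤ) =
        2 * q * n - 3 * q - 2 - (if q = 2 then 1 else 0)) ∧
    (3 ≤ q → ∀ x x' : Fin (5 + (n - 5)) → Fin q,
      x = Fin.append ![0, 1, 2, 0, 1] (alternating 0 1 (n - 5)) →
      x' = Fin.append ![1, 0, 2, 0, 1] (alternating 0 1 (n - 5)) →
      hammingDist x x' = 2 ∧
      ((delSubBall 1 1 x ∩ delSubBall 1 1 x').ncard : ℤ) =
        2 * q * n - 3 * q - 2 - (if q = 2 then 1 else 0)) ∧
    (q = 2 → ∀ x x' : Fin (4 + (n - 4)) → Fin q,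
      x = Fin.append ![0, 1, 0, 1] (alternating 0 1 (n - 4)) →
      x' = Fin.append ![1, 0, 0, 1] (alternating 0 1 (n - 4)) →
      hammingDist x x' = 2 ∧
      ((delSubBall 1 1 x ∩ delSubBall 1 1 x').ncard : ℤ) =
        2 * q * n - 3 * q - 2 - (if q = 2 then 1 else 0)) := by
  have hq' : (2 : ℝ) ≤ q := mod_cast hq
  rw [max_le_iff, div_le_iff₀ two_pos, div_le_iff₀ (by linarith)] at hn
  have hn₁ : Fintype.card (Fin q) + 16 ≤ 2 * n := by
    rw [Fintype.card_fin, mul_comm]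
    exact mod_cast hn.1
  have hn₂ : 5 * Fintype.card (Fin q) + 14 ≤ (Fintype.card (Fin q) - 1) * n := by
    rw [Fintype.card_fin, mul_comm _ n, ← Nat.cast_le (α := ℝ)]
    push_cast [show 1 ≤ q by omega]
    exact hn.2
  have h01 : (0 : Fin q) ≠ 1 := by simp [Fin.ext_iff, Nat.mod_eq_of_lt (show 1 < q by omega)]
  refine ⟨fun x x' => by simpa using ncard_delSubBall_inter_le (x := x) (x' := x') hn₁ hn₂,
    by simpa using exists_ncard_delSubBall_inter_eq hn₁ hn₂, ?_, ?_⟩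
  · intro hq x x' hx hx'
    have hlen : 5 + (n - 5) = n := by omega
    have h20 : (2 : Fin q) ≠ 0 := by simp [Fin.ext_iff, Nat.mod_eq_of_lt (show 2 < q by omega)]
    have h21 : (2 : Fin q) ≠ 1 := by
      simp [Fin.ext_iff, Nat.mod_eq_of_lt (show 1 < q by omega), Nat.mod_eq_of_lt hq]
    have h := ncard_delSubBall_inter_transposition (x := x) (x' := x')
      (by rwa [hlen]) (by rwa [hlen]) h01 (c := 2)
      (t := 0 :: 1 :: List.ofFn (alternating 0 1 (n - 5))) (by simp [h20, h21])
      (by simp [hx, List.ofFn_fin_append, List.ofFn_succ])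
      (by simp [hx', List.ofFn_fin_append, List.ofFn_succ])
      (.cons_cons h20 (.cons_cons h01 (isChain_cons_ofFn_alternating h01.symm h01 _)))
    rwa [Int.natCast_inj.2 hlen, Fintype.card_fin] at h
  · intro hq x x' hx hx'
    have hlen : 4 + (n - 4) = n := by omega
    have h := ncard_delSubBall_inter_transposition (x := x) (x' := x')
      (by rwa [hlen]) (by rwa [hlen]) h01 (c := 0)
      (t := 1 :: List.ofFn (alternating 0 1 (n - 4))) (by simp [hq])
      (by simp [hx, List.ofFn_fin_append, List.ofFn_succ])
      (by simp [hx', List.ofFn_fin_append, List.ofFn_succ])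
      (.cons_cons h01 (isChain_cons_ofFn_alternating h01.symm h01 _))
    rwa [Int.natCast_inj.2 hlen, Fintype.card_fin] at h

theorem theorem1 (q n : ℕ) [NeZero q] (hq : 2 ≤ q)
    (hn : max (((q : ℝ) + 23) / 2) ((5 * (q : ℝ) + 19) / ((q : ℝ) - 1)) ≤ (n : ℝ)) :
    -- the upper bound
    (∀ x x' : Fin n → Fin q, 2 ≤ hammingDist x x' →
      ((delSubBall 1 1 x ∩ delSubBall 1 1 x').ncard : ℤ) ≤
        2 * q * n - 3 * q - 2 - (if q = 2 then 1 else 0)) ∧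
    -- the bound is attained by words at distance exactly two
    (∃ x x' : Fin n → Fin q, hammingDist x x' = 2 ∧
      ((delSubBall 1 1 x ∩ delSubBall 1 1 x').ncard : ℤ) =
        2 * q * n - 3 * q - 2 - (if q = 2 then 1 else 0)) ∧
    -- an extremal pair for `q ≥ 3`; the length `5 + (n - 5)` is `n`
    (3 ≤ q → ∀ x x' : Fin (5 + (n - 5)) → Fin q,
      x = Fin.append ![0, 1, 2, 0, 1] (alternating 0 1 (n - 5)) →
      x' = Fin.append ![1, 0, 2, 0, 1] (alternating 0 1 (n - 5)) →
      hammingDist x x' = 2 ∧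
      ((delSubBall 1 1 x ∩ delSubBall 1 1 x').ncard : ℤ) =
        2 * q * n - 3 * q - 2 - (if q = 2 then 1 else 0)) ∧
    -- an extremal pair for `q = 2`; the length `4 + (n - 4)` is `n`
    (q = 2 → ∀ x x' : Fin (4 + (n - 4)) → Fin q,
      x = Fin.append ![0, 1, 0, 1] (alternating 0 1 (n - 4)) →
      x' = Fin.append ![1, 0, 0, 1] (alternating 0 1 (n - 4)) →
      hammingDist x x' = 2 ∧
      ((delSubBall 1 1 x ∩ delSubBall 1 1 x').ncard : ℤ) =
        2 * q * n - 3 * q - 2 - (if q = 2 then 1 else 0)) :=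
  theorem1_general q n hq <| le_trans (max_le_max (by linarith)
    (div_le_div_of_nonneg_right (by linarith) (sub_nonneg.2 (mod_cast by omega)))) hn
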